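/- Let $(\mathcal U,g)$ be a smooth Lorentzian manifold (signature $(-,+,\dots,+)$), let $\Phi:\mathcal U\to\mathbb R$ be smooth with $d\Phi\neq0$ on $\Phi^{-1}(0)$, let $\mathcal M=\Phi^{-1}(0)$ with the induced symmetric form $g^{\mathcal M}$, and suppose that the null spaces $\mathcal N_X=\{v\in T_X\mathcal M: g^{\mathcal M}(v,w)=0\ \forall w\in T_X\mathcal M\}$ have constant dimension $k\ge1$ and form an involutive distribution. Let $\mathcal S$ be a smooth distribution with $T\mathcal M=\mathcal N\oplus\mathcal S$. Let $\mathcal V$ be a $C^2$ vector field on $\mathcal M$ such that $[\mathcal V,W]$ is a section of $\mathcal N$ for every smooth section $W$ of $\mathcal N$, and let $\mathcal V_{\mathcal S}$ be its $\mathcal S$-component. Suppose that the leaves of the foliation integrating $\mathcal N$ are compact, that the leaf space $\mathcal M_{\mathrm{red}}$ is Hausdorff in the quotient topology and carries a smooth manifold structure for which the projection $\pi:\mathcal M\to\mathcal M_{\mathrm{red}}$ is a smooth submersion, and that $g^{\mathcal M}|_{\mathcal S}$ induces a smooth Riemannian metric $g_{\mathrm{red}}$ on $\mathcal M_{\mathrm{red}}$,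 that is, $g_{\mathrm{red}}(D\pi_X v,D\pi_X w)=g^{\mathcal M}(v,w)$ for all $X\in\mathcal M$ and $v,w\in T_X\mathcal M$ (equivalently, for all $v,w\in\mathcal S_X$). Suppose that $\mathcal M_{\mathrm{red}}$ is complete for the distance of $g_{\mathrm{red}}$. Let $\Psi:\mathcal M\to\mathbb R$ be a $C^1$ function with $d\Psi|_{\mathcal N}=0$ for which there is a constant $c>0$ with $d\Psi(\mathcal V_{\mathcal S})\le -c\,g^{\mathcal M}(\mathcal V_{\mathcal S},\mathcal V_{\mathcal S})$ on $\mathcal M$. Suppose that $\Psi$ is proper in the sense that every sublevel set $\{\Psi\le a\}$, $a\in\mathbb R$, is bounded for the pseudo-distance of $g^{\mathcal M}$ (the infimum of $\int_0^1\sqrt{g^{\mathcal M}(\dot\gamma,\dot\gamma)}\,dt$ over $C^1$ curves $\gamma$ joining two points), i.e. contained in a finite union of balls of finite radius; this holds in particular if all sublevel sets are compact. Then for every solution $X:[0,\infty)\to\mathcal M$ of $\dot X=\mathcal V(X)$, the projected trajectory $Y(t)=\pi(X(t))$ has a nonempty and relatively compact $\omega$-limit set $\{y\in\mathcal M_{\mathrm{red}}:\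 Y(t_k)\to y\text{ for some sequence } t_k\to\infty\}$ in $\mathcal M_{\mathrm{red}}$. -/

import Mathlib

open Set Filter Topology Bundle Manifold
open scoped ContDiff ENNReal

noncomputable section

namespace NullReduction

/-- A smooth Lorentzian metric, of signature `(-,+,…,+)`, on a manifold `U` of dimension `m + 1`. -/
structure LorentzianMetric (m : ℕ) (U : Type*) [TopologicalSpace U]
    [ChartedSpace (EuclideanSpace ℝ (Fin (m + 1))) U] [IsManifold (𝓡 (m + 1)) ∞ U] where
  /-- the bilinear form on each tangent space -/
  form : ∀ p : U, TangentSpace (𝓡 (m + 1)) p →L[ℝ] TangentSpace (𝓡 (m + 1)) p →L[ℝ] ℝ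
  smooth : ContMDiff (𝓡 (m + 1))
    ((𝓡 (m + 1)).prod 𝓘(ℝ, EuclideanSpace ℝ (Fin (m + 1)) →L[ℝ]
      EuclideanSpace ℝ (Fin (m + 1)) →L[ℝ] ℝ)) ∞
    (fun p ↦ TotalSpace.mk' (EuclideanSpace ℝ (Fin (m + 1)) →L[ℝ]
      EuclideanSpace ℝ (Fin (m + 1)) →L[ℝ] ℝ) p (form p))
  /-- every tangent space has an orthonormal basis with exactly one timelike vector
  (in particular the form is symmetric) -/
  signature : ∀ p : U, ∃ e : Module.Basis (Fin (m + 1)) ℝ (TangentSpace (𝓡 (m + 1)) p),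
    ∀ i j, form p (e i) (e j) = if i = j then (if i = 0 then -1 else 1) else 0

/-- `M`, embedded by `ι`, is the hypersurface `Φ = 0`, where `Φ` is a smooth function whose
differential vanishes nowhere on its zero set. -/
structure IsConstraintHypersurface (m : ℕ) {U M : Type*} [TopologicalSpace U]
    [ChartedSpace (EuclideanSpace ℝ (Fin (m + 1))) U]
    [TopologicalSpace M] [ChartedSpace (EuclideanSpace ℝ (Fin m)) M]
    (Φ : U → ℝ) (ι : M → U) : Prop where
  smooth : ContMDiff (𝓡 (m + 1)) 𝓘(ℝ) ∞ Φ
  regular : ∀ p : U, Φ p = 0 → mfderiv (𝓡 (m + 1)) 𝓘(ℝ) Φ p ≠ 0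
  embedding : IsSmoothEmbedding (𝓡 m) (𝓡 (m + 1)) ∞ ι
  range_eq : Set.range ι = {p | Φ p = 0}

/-- The form induced on `M` by the ambient metric: its pullback under the embedding. -/
def inducedForm {m : ℕ} {U M : Type*} [TopologicalSpace U]
    [ChartedSpace (EuclideanSpace ℝ (Fin (m + 1))) U] [IsManifold (𝓡 (m + 1)) ∞ U]
    [TopologicalSpace M] [ChartedSpace (EuclideanSpace ℝ (Fin m)) M]
    (g : LorentzianMetric m U) (ι : M → U) (x : M)
    (v w : TangentSpace (𝓡 m) x) : ℝ :=
  g.form (ι x) (mfderiv (𝓡 m) (𝓡 (m + 1)) ι x v) (mfderiv (𝓡 m) (𝓡 (m + 1)) ι x w)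

/-- The null distribution: at each point, the kernel of the induced form. -/
def nullDistribution {m : ℕ} {U M : Type*} [TopologicalSpace U]
    [ChartedSpace (EuclideanSpace ℝ (Fin (m + 1))) U] [IsManifold (𝓡 (m + 1)) ∞ U]
    [TopologicalSpace M] [ChartedSpace (EuclideanSpace ℝ (Fin m)) M]
    (g : LorentzianMetric m U) (ι : M → U) (x : M) : Submodule ℝ (TangentSpace (𝓡 m) x) where
  carrier := {v | ∀ w, inducedForm g ι x v w = 0}
  zero_mem' := by intro w; simp [inducedForm]
  add_mem' := by
    intro a b ha hb w
    have h1 := ha w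
    have h2 := hb w
    simp only [inducedForm] at h1 h2 ⊢
    rw [map_add, map_add, add_apply, h1, h2, add_zero]
  smul_mem' := by
    intro c a ha w
    have h1 := ha w
    simp only [inducedForm] at h1 ⊢
    rw [map_smul, map_smul, smul_apply, h1, smul_zero]

section Manifold

variable {m : ℕ} {M : Type*} [TopologicalSpace M] [ChartedSpace (EuclideanSpace ℝ (Fin m)) M]

/-- A vector field of class `C^j`. -/
def IsVectorFieldOfClass [IsManifold (𝓡 m) ∞ M] (j : ℕ∞)
    (W : ∀ x : M, TangentSpace (𝓡 m) x) : Prop :=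
  ContMDiff (𝓡 m) (𝓡 m).tangent j (fun x ↦ (⟨x, W x⟩ : TangentBundle (𝓡 m) M))

/-- A smooth vector field with values in the distribution `N`. -/
def IsSmoothSection [IsManifold (𝓡 m) ∞ M] (N : ∀ x : M, Submodule ℝ (TangentSpace (𝓡 m) x))
    (W : ∀ x : M, TangentSpace (𝓡 m) x) : Prop :=
  IsVectorFieldOfClass ⊤ W ∧ ∀ x, W x ∈ N x

/-- A smooth distribution (subbundle of the tangent bundle): near each point it has a frame
consisting of smooth vector fields. -/
def IsSmoothDistribution [IsManifold (𝓡 m) ∞ M]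
    (S : ∀ x : M, Submodule ℝ (TangentSpace (𝓡 m) x)) : Prop :=
  ∀ x₀ : M, ∃ (O : Set M) (r : ℕ) (W : Fin r → ∀ x : M, TangentSpace (𝓡 m) x),
    IsOpen O ∧ x₀ ∈ O ∧
    (∀ i, ContMDiffOn (𝓡 m) (𝓡 m).tangent ∞
      (fun x ↦ (⟨x, W i x⟩ : TangentBundle (𝓡 m) M)) O) ∧
    ∀ x ∈ O, LinearIndependent ℝ (fun i ↦ W i x) ∧
      Submodule.span ℝ (Set.range fun i ↦ W i x) = S x

/-- Involutivity: the Lie bracket of two smooth sections is a section. -/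
def IsInvolutive [IsManifold (𝓡 m) ∞ M]
    (N : ∀ x : M, Submodule ℝ (TangentSpace (𝓡 m) x)) : Prop :=
  ∀ W₁ W₂, IsSmoothSection N W₁ → IsSmoothSection N W₂ →
    ∀ x, VectorField.mlieBracket (𝓡 m) W₁ W₂ x ∈ N x

/-- The vector field `V` preserves `N`: the Lie bracket of `V` with every smooth section of `N` is
again a section of `N`. -/
def PreservesDistribution [IsManifold (𝓡 m) ∞ M] (V : ∀ x : M, TangentSpace (𝓡 m) x)
    (N : ∀ x : M, Submodule ℝ (TangentSpace (𝓡 m) x)) : Prop :=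
  ∀ W, IsSmoothSection N W → ∀ x, VectorField.mlieBracket (𝓡 m) V W x ∈ N x

/-- Two points are joined by a `C^1` curve everywhere tangent to `N`. -/
def JoinedTangentTo (N : ∀ x : M, Submodule ℝ (TangentSpace (𝓡 m) x)) (x y : M) : Prop :=
  ∃ γ : ℝ → M, ContMDiffOn 𝓘(ℝ) (𝓡 m) 1 γ (Icc 0 1) ∧ γ 0 = x ∧ γ 1 = y ∧
    ∀ t ∈ Icc (0 : ℝ) 1, mfderivWithin 𝓘(ℝ) (𝓡 m) γ (Icc 0 1) t (1 : ℝ) ∈ N (γ t)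

/-- The relation of lying on the same leaf of the foliation that integrates `N`: two points are
equivalent when they are joined by a finite chain of `C^1` curves tangent to `N`. -/
def leafSetoid (N : ∀ x : M, Submodule ℝ (TangentSpace (𝓡 m) x)) : Setoid M :=
  Relation.EqvGen.setoid (JoinedTangentTo N)

/-- The leaf through `x`. -/
def leaf (N : ∀ x : M, Submodule ℝ (TangentSpace (𝓡 m) x)) (x : M) : Set M :=
  {y | leafSetoid N x y}

/-- The leaf space, with the quotient topology. -/
def LeafSpace (N : ∀ x : M, Submodule ℝ (TangentSpace (𝓡 m) x)) : Type _ :=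
  Quotient (leafSetoid N)

instance (N : ∀ x : M, Submodule ℝ (TangentSpace (𝓡 m) x)) : TopologicalSpace (LeafSpace N) :=
  inferInstanceAs (TopologicalSpace (Quotient (leafSetoid N)))

/-- The canonical projection onto the leaf space. -/
def leafProj (N : ∀ x : M, Submodule ℝ (TangentSpace (𝓡 m) x)) (x : M) : LeafSpace N :=
  Quotient.mk (leafSetoid N) x

/-- The `S`-component of the vector field `V` for the splitting of the tangent bundle into `N`
and `S`. -/
def transversalPart {N S : ∀ x : M, Submodule ℝ (TangentSpace (𝓡 m) x)}
    (h : ∀ x, IsCompl (S x) (N x)) (V : ∀ x : M, TangentSpace (𝓡 m) x) (x : M) :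
    TangentSpace (𝓡 m) x :=
  (S x).projection (N x) (h x) (V x)

/-- The derivative at `x` of the real function `Ψ` in the direction of the tangent vector `v`. -/
def dirDeriv (Ψ : M → ℝ) (x : M) (v : TangentSpace (𝓡 m) x) : ℝ :=
  mfderiv (𝓡 m) 𝓘(ℝ) Ψ x v

/-- `Ψ` is compatible with `N`: its differential vanishes on `N`. -/
def IsCompatible (Ψ : M → ℝ) (N : ∀ x : M, Submodule ℝ (TangentSpace (𝓡 m) x)) : Prop :=
  ∀ x, ∀ v ∈ N x, dirDeriv Ψ x v = 0

/-- The (extended) pseudo-distance of a positive semidefinite field `b` of bilinear forms: the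
infimum over `C^1` curves of the integral of `√(b(γ', γ'))`. -/
def formEDist (b : ∀ x : M, TangentSpace (𝓡 m) x → TangentSpace (𝓡 m) x → ℝ) (x y : M) : ℝ≥0∞ :=
  letI : ∀ x : M, ENorm (TangentSpace (𝓡 m) x) := fun x ↦ ⟨fun v ↦ ENNReal.ofReal √(b x v v)⟩
  riemannianEDist (𝓡 m) x y

/-- `A` is bounded for the pseudo-distance of `b`: it is covered by finitely many balls of finite
radius (on a connected manifold: it has finite diameter). Every compact set is bounded when `b` is
continuous. -/
def IsFormBounded (b : ∀ x : M, TangentSpace (𝓡 m) x → TangentSpace (𝓡 m) x → ℝ)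
    (A : Set M) : Prop :=
  ∃ (F : Finset M) (R : ℝ), ∀ y ∈ A, ∃ x ∈ F, formEDist b x y ≤ ENNReal.ofReal R

/-- Properness of a real function, in the sense that all its sublevel sets are bounded. It holds in
particular when all sublevel sets are compact and `b` is continuous. -/
def HasBoundedSublevels (b : ∀ x : M, TangentSpace (𝓡 m) x → TangentSpace (𝓡 m) x → ℝ)
    (Ψ : M → ℝ) : Prop :=
  ∀ a : ℝ, IsFormBounded b {x | Ψ x ≤ a}

/-- Completeness for the Riemannian distance: every Cauchy sequence converges. -/
def IsRiemannianComplete (r : ℕ) (B : Type*) [TopologicalSpace B]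
    [ChartedSpace (EuclideanSpace ℝ (Fin r)) B]
    [RiemannianBundle (fun y : B ↦ TangentSpace (𝓡 r) y)] : Prop :=
  ∀ u : ℕ → B,
    (∀ ε : ℝ≥0∞, 0 < ε → ∃ n₀, ∀ i ≥ n₀, ∀ j ≥ n₀, riemannianEDist (𝓡 r) (u i) (u j) < ε) →
    ∃ y, Tendsto u atTop (𝓝 y)

end Manifold

/-- The `ω`-limit set of a curve: all limits along sequences of times tending to infinity. -/
def omegaLimitSet {B : Type*} [TopologicalSpace B] (Y : ℝ → B) : Set B :=
  {y | ∃ t : ℕ → ℝ, Tendsto t atTop atTop ∧ Tendsto (fun k ↦ Y (t k)) atTop (𝓝 y)}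

/-- The reduced space: the leaf space of the null distribution. -/
abbrev ReducedSpace {m : ℕ} {U M : Type*} [TopologicalSpace U]
    [ChartedSpace (EuclideanSpace ℝ (Fin (m + 1))) U] [IsManifold (𝓡 (m + 1)) ∞ U]
    [TopologicalSpace M] [ChartedSpace (EuclideanSpace ℝ (Fin m)) M]
    (g : LorentzianMetric m U) (ι : M → U) : Type _ :=
  LeafSpace (nullDistribution g ι)

/-- The canonical projection of the constraint hypersurface onto the reduced space. -/
abbrev reducedProj {m : ℕ} {U M : Type*} [TopologicalSpace U]
    [ChartedSpace (EuclideanSpace ℝ (Fin (m + 1))) U] [IsManifold (𝓡 (m + 1)) ∞ U]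
    [TopologicalSpace M] [ChartedSpace (EuclideanSpace ℝ (Fin m)) M]
    (g : LorentzianMetric m U) (ι : M → U) : M → ReducedSpace g ι :=
  leafProj (nullDistribution g ι)

/-- The Riemannian metric on the reduced space is the one induced by the form of `M`: whenever
`u = Dπ_x(v)` and `u' = Dπ_x(v')`, the inner product of `u` and `u'` is the value of the induced
form at `(v, v')`. As null vectors lie in the kernel of `Dπ_x` and in that of the form, this is the
same as asking it for `v`, `v'` in a complement of the null space. -/
def IsInducedMetric {m r : ℕ} {U M : Type*} [TopologicalSpace U]
    [ChartedSpace (EuclideanSpace ℝ (Fin (m + 1))) U] [IsManifold (𝓡 (m + 1)) ∞ U]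
    [TopologicalSpace M] [ChartedSpace (EuclideanSpace ℝ (Fin m)) M]
    (g : LorentzianMetric m U) (ι : M → U)
    [ChartedSpace (EuclideanSpace ℝ (Fin r)) (ReducedSpace g ι)]
    [RiemannianBundle (fun y : ReducedSpace g ι ↦ TangentSpace (𝓡 r) y)] : Prop :=
  ∀ (x : M) (v v' : TangentSpace (𝓡 m) x),
    inner ℝ (mfderiv (𝓡 m) (𝓡 r) (reducedProj g ι) x v)
      (mfderiv (𝓡 m) (𝓡 r) (reducedProj g ι) x v') = inducedForm g ι x v v'

end NullReduction

end

/-! Since `dΨ` kills null vectors, `dΨ(V) = dΨ(V_S) ≤ -c g(V_S, V_S)`. The induced form is the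
pullback of a Riemannian metric, hence nonnegative, so `Ψ` decreases weakly along the trajectory
(`antitoneOn_comp_of_isMIntegralCurveOn`), which stays in the sublevel set of its initial value.
That set is bounded for the pseudo-distance, and the projection preserves lengths of curves
(`riemannianEDist_le_formEDist`), so the projected trajectory stays in finitely many closed balls of
the reduced space. These are compact by Hopf–Rinow, and compactness yields the limit points and
confines them.

Hopf–Rinow is proved without geodesics: near-minimizing curves give approximate intermediate points,
and the supremum of the radii of compact balls can be neither finite and unattained nor finite and
attained. -/

namespace NullReduction

/-! ### Hopf–Rinow without geodesics -/

/-- The compactness part of the **Hopf–Rinow** theorem for length spaces: in a complete locally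
compact space in which intermediate points exist up to an arbitrarily small error, all closed balls
of finite radius are compact. -/
theorem isCompact_closedEBall_of_exists_intermediate {B : Type*} [PseudoEMetricSpace B]
    [CompleteSpace B] [WeaklyLocallyCompactSpace B]
    (hmid : ∀ (x y : B) (a b : NNReal), 0 < b → edist x y < a + b →
      ∃ z, edist x z ≤ a ∧ edist z y < b)
    (x : B) (R : NNReal) : IsCompact (Metric.closedEBall x (R : ℝ≥0∞)) := by
  have hsub : ∀ {K : Set B} {ρ : NNReal}, IsCompact K → Metric.closedEBall x ρ ⊆ K →
      IsCompact (Metric.closedEBall x (ρ : ℝ≥0∞)) := fun hK h ↦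
    hK.of_isClosed_subset Metric.isClosed_closedEBall h
  by_contra hR
  set A : Set NNReal := {ρ | IsCompact (Metric.closedEBall x (ρ : ℝ≥0∞))}
  have hbdd : BddAbove A := ⟨R, fun ρ hρ ↦ by
    by_contra! h
    exact hR (hsub hρ (Metric.closedEBall_subset_closedEBall (by exact_mod_cast h.le)))⟩
  -- A compact `K` has a compact neighbourhood containing some `δ`-thickening of `K`. The hypothesis
  -- on `K` puts the open ball of radius `ρ + δ` in it; halving `δ` makes room for a closed ball.
  have hext : ∀ {K : Set B} {ρ : NNReal}, IsCompact K → (∀ η : NNReal, 0 < η →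
      ∀ y, edist x y < (ρ : ℝ≥0∞) + η → ∃ z ∈ K, edist z y < η) →
      ∃ η : NNReal, 0 < η ∧ ρ + η / 2 ∈ A := by
    intro K ρ hK h
    obtain ⟨K', hK', hKK'⟩ := exists_compact_superset hK
    obtain ⟨δ, hδ, hδK⟩ := hK.exists_thickening_subset_open isOpen_interior hKK'
    lift δ to NNReal using hδ.le
    replace hδ : 0 < δ := by exact_mod_cast hδ
    refine ⟨δ, hδ, hsub hK' fun y hy ↦ interior_subset (hδK ?_)⟩
    rw [Metric.mem_closedEBall'] at hy
    obtain ⟨z, hz, hzy⟩ := h δ hδ y (hy.trans_lt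
      (by exact_mod_cast add_lt_add_right (NNReal.half_lt_self hδ.ne') ρ))
    rw [Metric.mem_thickening_iff_exists_edist_lt]
    exact ⟨z, hz, by rwa [edist_comm, ENNReal.ofReal_coe_nnreal]⟩
  obtain ⟨η₀, -, h₀⟩ := hext (ρ := 0) (isCompact_singleton (x := x))
    fun η _ y hy ↦ ⟨x, rfl, by simpa using hy⟩
  -- The supremum is attained: a point of this ball lies within `η < ε / 2` of a compact ball of
  -- slightly smaller radius, so an `ε / 2`-net of the latter is an `ε`-net here.
  have hsA : IsCompact (Metric.closedEBall x ((sSup A : NNReal) : ℝ≥0∞)) := by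
    refine isCompact_iff_totallyBounded_isComplete.2
      ⟨EMetric.totallyBounded_iff.2 fun ε hε ↦ ?_, Metric.isClosed_closedEBall.isComplete⟩
    obtain ⟨η, hη, hηε⟩ := ENNReal.lt_iff_exists_nnreal_btwn.1 (ENNReal.half_pos hε.ne')
    replace hη : 0 < η := by exact_mod_cast hη
    obtain ⟨ρ, hρ, hsρ⟩ : ∃ ρ ∈ A, sSup A < ρ + η := by
      by_contra! h
      have h1 : sSup A ≤ sSup A - η := csSup_le ⟨_, h₀⟩ fun ρ hρ ↦ le_tsub_of_add_le_right (h ρ hρ)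
      -- Subtraction in `NNReal` is truncated, so the contradiction needs `0 < sSup A`.
      have h2 : η ≤ sSup A := le_of_add_le_right (h _ h₀)
      exact absurd h1 (not_le.2 (tsub_lt_self (hη.trans_le h2) hη))
    obtain ⟨t, ht, htρ⟩ := EMetric.totallyBounded_iff.1 (IsCompact.totallyBounded hρ) (ε / 2)
      (ENNReal.half_pos hε.ne')
    refine ⟨t, ht, fun y hy ↦ ?_⟩
    rw [Metric.mem_closedEBall'] at hy
    obtain ⟨z, hxz, hzy⟩ := hmid x y ρ η hη (hy.trans_lt (by exact_mod_cast hsρ))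
    obtain ⟨w, hw, hzw⟩ := mem_iUnion₂.1 (htρ (Metric.mem_closedEBall'.2 hxz))
    refine mem_iUnion₂.2 ⟨w, hw, ?_⟩
    rw [Metric.mem_eball] at hzw ⊢
    calc edist y w ≤ edist z y + edist z w := edist_triangle_left _ _ _
      _ < ε / 2 + ε / 2 := ENNReal.add_lt_add (hzy.trans hηε) hzw
      _ = ε := ENNReal.add_halves ε
  -- Extending the ball of radius `sSup A` now exceeds the supremum.
  obtain ⟨η, hη, h⟩ := hext hsA fun η hη y hy ↦ by
    obtain ⟨z, hxz, hzy⟩ := hmid x y _ η hη hy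
    exact ⟨z, Metric.mem_closedEBall'.2 hxz, hzy⟩
  exact absurd (le_csSup hbdd h) (not_le.2 (lt_add_of_pos_right _ (half_pos hη)))

section Riemannian

variable {E : Type*} [NormedAddCommGroup E] [NormedSpace ℝ E] {H : Type*} [TopologicalSpace H]
  {I : ModelWithCorners ℝ E H}

/-- In a Riemannian manifold, intermediate points exist up to an arbitrarily small error. -/
theorem exists_intermediate_of_isRiemannianManifold {B : Type*} [PseudoEMetricSpace B]
    [ChartedSpace H B] [RiemannianBundle (fun y : B ↦ TangentSpace I y)]
    [IsRiemannianManifold I B] (x y : B) (a b : NNReal) (hb : 0 < b) (h : edist x y < a + b) :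
    ∃ z, edist x z ≤ a ∧ edist z y < b := by
  rcases le_total (edist x y) a with hxy | hxy
  · exact ⟨y, hxy, by simpa using hb⟩
  rw [IsRiemannianManifold.out (I := I)] at h
  obtain ⟨γ, rfl, rfl, hγ, hlen⟩ := exists_lt_of_riemannianEDist_lt h
  have hcont : ContinuousOn (fun t ↦ edist (γ 0) (γ t)) (Icc 0 1) :=
    (continuous_const.edist continuous_id).comp_continuousOn hγ.continuousOn
  -- Cut a curve of length less than `a + b` where its distance from `x` equals `a`: the first piece
  -- has length at least `a`, leaving less than `b` for the second.
  obtain ⟨t, ht, hat⟩ := intermediate_value_Icc zero_le_one hcont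
    (show (a : ℝ≥0∞) ∈ Icc _ _ from ⟨by simp, hxy⟩)
  change edist (γ 0) (γ t) = a at hat
  refine ⟨γ t, hat.le, ?_⟩
  have h₁ : (a : ℝ≥0∞) ≤ pathELength I γ 0 t := by
    rw [← hat, IsRiemannianManifold.out (I := I)]
    exact riemannianEDist_le_pathELength (hγ.mono (Icc_subset_Icc_right ht.2)) rfl rfl ht.1
  have h₂ : edist (γ t) (γ 1) ≤ pathELength I γ t 1 := by
    rw [IsRiemannianManifold.out (I := I)]
    exact riemannianEDist_le_pathELength (hγ.mono (Icc_subset_Icc_left ht.1)) rfl rfl ht.2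
  rw [← pathELength_add ht.1 ht.2] at hlen
  have h₃ := (add_le_add h₁ h₂).trans_lt hlen
  rwa [ENNReal.add_lt_add_iff_left ENNReal.coe_ne_top] at h₃

end Riemannian

/-- **Hopf–Rinow**: in a complete Riemannian manifold, closed balls are compact. -/
theorem isCompact_riemannianEDist_le {r : ℕ} {B : Type*} [TopologicalSpace B] [T2Space B]
    [ChartedSpace (EuclideanSpace ℝ (Fin r)) B] [IsManifold (𝓡 r) ∞ B]
    [RiemannianBundle (fun y : B ↦ TangentSpace (𝓡 r) y)]
    [IsContMDiffRiemannianBundle (𝓡 r) ∞ (EuclideanSpace ℝ (Fin r))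
      (fun y : B ↦ TangentSpace (𝓡 r) y)]
    (hB : IsRiemannianComplete r B) (x : B) (R : NNReal) :
    IsCompact {y | riemannianEDist (𝓡 r) x y ≤ R} := by
  have : LocallyCompactSpace B := Manifold.locallyCompact_of_finiteDimensional (𝓡 r)
  have : IsManifold (𝓡 r) 1 B := IsManifold.of_le (n := ∞) (by simp)
  have : IsContinuousRiemannianBundle (EuclideanSpace ℝ (Fin r))
      (fun y : B ↦ TangentSpace (𝓡 r) y) := by
    obtain ⟨g, hg, hg'⟩ := IsContMDiffRiemannianBundle.exists_contMDiff (IB := 𝓡 r) (n := ∞)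
      (F := EuclideanSpace ℝ (Fin r)) (E := fun y : B ↦ TangentSpace (𝓡 r) y)
    exact ⟨g, hg.continuous, hg'⟩
  -- The topology of this structure is the given one, so completeness and compactness carry over
  -- unchanged.
  let : PseudoEMetricSpace B := .ofRiemannianMetric (𝓡 r) B
  have : CompleteSpace B := EMetric.complete_of_cauchySeq_tendsto fun u hu ↦ hB u fun ε hε ↦ by
    obtain ⟨n, hn⟩ := EMetric.cauchySeq_iff.1 hu ε hε
    exact ⟨n, fun i hi j hj ↦ hn i hi j hj⟩
  have hball : {y | riemannianEDist (𝓡 r) x y ≤ R} = Metric.closedEBall x (R : ℝ≥0∞) := by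
    ext y
    rw [Metric.mem_closedEBall', IsRiemannianManifold.out (I := 𝓡 r), mem_ofPred_eq]
  rw [hball]
  exact isCompact_closedEBall_of_exists_intermediate
    (exists_intermediate_of_isRiemannianManifold (I := 𝓡 r)) x R

/-! ### Comparison of distances under the projection -/

/-- A `C^1` map that carries the form `b` to the Riemannian metric of the target does not increase
distances. -/
theorem riemannianEDist_le_formEDist {m r : ℕ} {M B : Type*}
    [TopologicalSpace M] [ChartedSpace (EuclideanSpace ℝ (Fin m)) M]
    [TopologicalSpace B] [ChartedSpace (EuclideanSpace ℝ (Fin r)) B]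
    [RiemannianBundle (fun y : B ↦ TangentSpace (𝓡 r) y)]
    {b : ∀ x : M, TangentSpace (𝓡 m) x → TangentSpace (𝓡 m) x → ℝ} {f : M → B}
    (hf : ContMDiff (𝓡 m) (𝓡 r) 1 f)
    (hb : ∀ x v, inner ℝ (mfderiv (𝓡 m) (𝓡 r) f x v) (mfderiv (𝓡 m) (𝓡 r) f x v) = b x v v)
    (x y : M) : riemannianEDist (𝓡 r) (f x) (f y) ≤ formEDist b x y := by
  let : ∀ x : M, ENorm (TangentSpace (𝓡 m) x) := fun x ↦ ⟨fun v ↦ ENNReal.ofReal √(b x v v)⟩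
  refine le_of_forall_gt fun c hc ↦ ?_
  obtain ⟨γ, rfl, rfl, hγ, hlen⟩ := exists_lt_of_riemannianEDist_lt (I := 𝓡 m) hc
  -- The image curve has exactly the same length: by the chain rule the integrands agree pointwise.
  refine (riemannianEDist_le_pathELength (γ := f ∘ γ) (a := 0) (b := 1)
    (hf.comp_contMDiffOn hγ) rfl rfl zero_le_one).trans_lt (lt_of_eq_of_lt ?_ hlen)
  rw [pathELength_eq_lintegral_mfderivWithin_Icc, pathELength_eq_lintegral_mfderivWithin_Icc]
  refine MeasureTheory.setLIntegral_congr_fun measurableSet_Icc fun t ht ↦ ?_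
  have hcomp : mfderivWithin 𝓘(ℝ) (𝓡 r) (f ∘ γ) (Icc 0 1) t
      = (mfderiv (𝓡 m) (𝓡 r) f (γ t)).comp (mfderivWithin 𝓘(ℝ) (𝓡 m) γ (Icc 0 1) t) :=
    mfderiv_comp_mfderivWithin t ((hf _).mdifferentiableAt (by simp))
      ((hγ t ht).mdifferentiableWithinAt (by simp))
      (uniqueMDiffWithinAt_iff_uniqueDiffWithinAt.2 (uniqueDiffOn_Icc zero_lt_one t ht))
  simp only [hcomp]
  change ‖mfderiv (𝓡 m) (𝓡 r) f (γ t) (mfderivWithin 𝓘(ℝ) (𝓡 m) γ (Icc 0 1) t 1)‖ₑ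
    = ENNReal.ofReal √(b _ _ _)
  rw [← ofReal_norm, norm_eq_sqrt_real_inner, hb]

/-- The image of a set bounded for the form `b` under a `C^1` map that carries `b` to a complete
Riemannian metric is contained in a compact set. -/
theorem IsFormBounded.exists_isCompact_image_subset {m r : ℕ} {M B : Type*}
    [TopologicalSpace M] [ChartedSpace (EuclideanSpace ℝ (Fin m)) M]
    [TopologicalSpace B] [T2Space B] [ChartedSpace (EuclideanSpace ℝ (Fin r)) B]
    [IsManifold (𝓡 r) ∞ B]
    [RiemannianBundle (fun y : B ↦ TangentSpace (𝓡 r) y)]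
    [IsContMDiffRiemannianBundle (𝓡 r) ∞ (EuclideanSpace ℝ (Fin r))
      (fun y : B ↦ TangentSpace (𝓡 r) y)]
    {b : ∀ x : M, TangentSpace (𝓡 m) x → TangentSpace (𝓡 m) x → ℝ} {A : Set M}
    (hA : IsFormBounded b A) {f : M → B} (hf : ContMDiff (𝓡 m) (𝓡 r) 1 f)
    (hb : ∀ x v, inner ℝ (mfderiv (𝓡 m) (𝓡 r) f x v) (mfderiv (𝓡 m) (𝓡 r) f x v) = b x v v)
    (hB : IsRiemannianComplete r B) : ∃ K, IsCompact K ∧ f '' A ⊆ K := by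
  obtain ⟨F, R, hF⟩ := hA
  refine ⟨⋃ x ∈ F, {y | riemannianEDist (𝓡 r) (f x) y ≤ R.toNNReal},
    F.isCompact_biUnion fun x _ ↦ isCompact_riemannianEDist_le hB (f x) R.toNNReal, ?_⟩
  rintro _ ⟨y, hy, rfl⟩
  obtain ⟨x, hx, hxy⟩ := hF y hy
  exact mem_iUnion₂.2 ⟨x, hx, (riemannianEDist_le_formEDist hf hb x y).trans hxy⟩

/-! ### Monotonicity along trajectories -/

/-- A `C^1` function whose derivative along `V` is nonpositive is nonincreasing along the integral
curves of `V`. -/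
theorem antitoneOn_comp_of_isMIntegralCurveOn {m : ℕ} {M : Type*} [TopologicalSpace M]
    [ChartedSpace (EuclideanSpace ℝ (Fin m)) M] {V : ∀ x : M, TangentSpace (𝓡 m) x} {Ψ : M → ℝ}
    (hΨ : ContMDiff (𝓡 m) 𝓘(ℝ) 1 Ψ) (hV : ∀ x, dirDeriv Ψ x (V x) ≤ 0) {X : ℝ → M} {D : Set ℝ}
    (hD : Convex ℝ D) (hX : IsMIntegralCurveOn X V D) : AntitoneOn (Ψ ∘ X) D := by
  have key : ∀ t ∈ D, HasDerivWithinAt (Ψ ∘ X) (dirDeriv Ψ (X t) (V (X t))) D t := fun t ht ↦ by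
    have h := ((hΨ (X t)).mdifferentiableAt (by simp)).hasMFDerivAt.comp_hasMFDerivWithinAt t
      (hX t ht)
    have h₁ : HasFDerivWithinAt (Ψ ∘ X) (ContinuousLinearMap.toSpanSingleton ℝ
        (dirDeriv Ψ (X t) (V (X t)))) D t := by
      refine h.hasFDerivWithinAt.congr_fderiv (ContinuousLinearMap.ext_ring ?_)
      change mfderiv (𝓡 m) 𝓘(ℝ) Ψ (X t) ((1 : ℝ) • V (X t)) = (1 : ℝ) • dirDeriv Ψ _ _
      rw [one_smul, one_smul]
      rfl
    exact h₁
  exact antitoneOn_of_hasDerivWithinAt_nonpos hD (fun t ht ↦ (key t ht).continuousWithinAt)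
    (fun t ht ↦ (key t (interior_subset ht)).mono interior_subset) fun t _ ↦ hV (X t)

/-- The differential of a function compatible with `N` depends only on transversal parts. -/
theorem IsCompatible.dirDeriv_transversalPart {m : ℕ} {M : Type*} [TopologicalSpace M]
    [ChartedSpace (EuclideanSpace ℝ (Fin m)) M]
    {N S : ∀ x : M, Submodule ℝ (TangentSpace (𝓡 m) x)} {Ψ : M → ℝ} (hΨ : IsCompatible Ψ N)
    (h : ∀ x, IsCompl (S x) (N x)) (V : ∀ x : M, TangentSpace (𝓡 m) x) (x : M) :
    dirDeriv Ψ x (transversalPart h V x) = dirDeriv Ψ x (V x) := by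
  have hmem : V x - transversalPart h V x ∈ N x :=
    Submodule.sub_projection_mem (h x) (V x)
  have h0 := hΨ x _ hmem
  rw [dirDeriv, map_sub] at h0
  exact (sub_eq_zero.1 h0).symm

/-! ### Limit sets of curves in compact sets -/

/-- A space with charts in a first countable space is first countable. -/
theorem firstCountableTopology_of_chartedSpace (H B : Type*) [TopologicalSpace H]
    [FirstCountableTopology H] [TopologicalSpace B] [ChartedSpace H B] :
    FirstCountableTopology B :=
  ⟨fun y ↦ by
    rw [← (chartAt H y).symm_map_nhds_eq (mem_chart_source H y)]
    infer_instance⟩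

/-- The `ω`-limit set of a curve that stays in a compact set at positive times. -/
theorem omegaLimitSet_nonempty_and_isCompact_closure {B : Type*} [TopologicalSpace B] [T2Space B]
    [FirstCountableTopology B] {Y : ℝ → B} {K : Set B} (hK : IsCompact K)
    (hY : ∀ t, 0 ≤ t → Y t ∈ K) :
    (omegaLimitSet Y).Nonempty ∧ IsCompact (closure (omegaLimitSet Y)) := by
  constructor
  -- Sample at integer times; first countability makes `K` sequentially compact.
  · obtain ⟨y, -, φ, hφ, hy⟩ := hK.tendsto_subseq fun n : ℕ ↦ hY n n.cast_nonneg
    exact ⟨y, fun n ↦ φ n, tendsto_natCast_atTop_atTop.comp hφ.tendsto_atTop, hy⟩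
  · refine hK.closure_of_subset ?_
    rintro y ⟨t, ht, hy⟩
    exact hK.isClosed.mem_of_tendsto hy ((ht.eventually_ge_atTop 0).mono fun k hk ↦ hY _ hk)

end NullReduction


/-! ### The main theorem -/

open NullReduction in
theorem proposition4 {m k r : ℕ}
    {U : Type*} [TopologicalSpace U] [T2Space U] [SecondCountableTopology U]
    [ChartedSpace (EuclideanSpace ℝ (Fin (m + 1))) U] [IsManifold (𝓡 (m + 1)) ∞ U]
    {M : Type*} [TopologicalSpace M]
    [ChartedSpace (EuclideanSpace ℝ (Fin m)) M] [IsManifold (𝓡 m) ∞ M]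
    -- the ambient Lorentzian manifold and the constraint hypersurface
    (g : LorentzianMetric m U) (Φ : U → ℝ) (ι : M → U)
    (hM : IsConstraintHypersurface m Φ ι)
    -- the null distribution has constant rank and is involutive
    (hk : 1 ≤ k) (hrank : ∀ x : M, Module.finrank ℝ (nullDistribution g ι x) = k)
    (hinv : IsInvolutive (nullDistribution g ι))
    -- a smooth transversal complement
    (S : ∀ x : M, Submodule ℝ (TangentSpace (𝓡 m) x)) (hS : IsSmoothDistribution S)
    (hcompl : ∀ x, IsCompl (S x) (nullDistribution g ι x))
    -- the intrinsic vector field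
    (V : ∀ x : M, TangentSpace (𝓡 m) x) (hV : IsVectorFieldOfClass 2 V)
    (hVN : PreservesDistribution V (nullDistribution g ι))
    -- compact leaves, Hausdorff leaf space with the quotient manifold structure
    (hleaf : ∀ x : M, IsCompact (leaf (nullDistribution g ι) x))
    [T2Space (ReducedSpace g ι)]
    [ChartedSpace (EuclideanSpace ℝ (Fin r)) (ReducedSpace g ι)]
    [IsManifold (𝓡 r) ∞ (ReducedSpace g ι)]
    (hsub : IsSubmersion (𝓡 m) (𝓡 r) ∞ (reducedProj g ι))
    -- the induced Riemannian metric on the leaf space is complete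
    [RiemannianBundle (fun y : ReducedSpace g ι ↦ TangentSpace (𝓡 r) y)]
    [IsContMDiffRiemannianBundle (𝓡 r) ∞ (EuclideanSpace ℝ (Fin r))
      (fun y : ReducedSpace g ι ↦ TangentSpace (𝓡 r) y)]
    (hmetric : IsInducedMetric (r := r) g ι)
    (hcomplete : IsRiemannianComplete r (ReducedSpace g ι))
    -- the compatible, transversally dissipative, proper functional
    (Ψ : M → ℝ) (hΨ : ContMDiff (𝓡 m) 𝓘(ℝ) 1 Ψ)
    (hcompat : IsCompatible Ψ (nullDistribution g ι))
    (hdiss : ∃ c : ℝ, 0 < c ∧ ∀ x : M,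
      dirDeriv Ψ x (transversalPart hcompl V x) ≤
        -c * inducedForm g ι x (transversalPart hcompl V x) (transversalPart hcompl V x))
    (hproper : HasBoundedSublevels (inducedForm g ι) Ψ)
    -- a trajectory, defined for all nonnegative times
    (X : ℝ → M) (hX : IsMIntegralCurveOn X V (Ici 0)) :
    (omegaLimitSet (fun t ↦ reducedProj g ι (X t))).Nonempty ∧
      IsCompact (closure (omegaLimitSet (fun t ↦ reducedProj g ι (X t)))) := by
  obtain ⟨c, hc, hdiss⟩ := hdiss
  have hπ : ContMDiff (𝓡 m) (𝓡 r) 1 (reducedProj g ι) := hsub.contMDiff.of_le (by simp)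
  have hnonneg : ∀ x v, 0 ≤ inducedForm g ι x v v := fun x v ↦ by
    rw [← hmetric x v v]
    exact real_inner_self_nonneg
  have hanti : AntitoneOn (Ψ ∘ X) (Ici 0) :=
    antitoneOn_comp_of_isMIntegralCurveOn hΨ (fun x ↦ by
      rw [← hcompat.dirDeriv_transversalPart hcompl V x]
      exact (hdiss x).trans (mul_nonpos_of_nonpos_of_nonneg (neg_nonpos.2 hc.le) (hnonneg _ _)))
      (convex_Ici 0) hX
  obtain ⟨K, hK, hsubK⟩ := IsFormBounded.exists_isCompact_image_subset (hproper (Ψ (X 0))) hπ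
    (fun x v ↦ hmetric x v v) hcomplete
  have := firstCountableTopology_of_chartedSpace (EuclideanSpace ℝ (Fin r)) (ReducedSpace g ι)
  exact omegaLimitSet_nonempty_and_isCompact_closure hK fun t ht ↦
    hsubK (mem_image_of_mem _ (hanti (mem_Ici.2 le_rfl) (mem_Ici.2 ht) ht))
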